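/- Let $\kappa$ be a regular uncountable cardinal and let $\mu$ be an infinite cardinal such that $\lambda^{<\mu}<\kappa$ for every cardinal $\lambda<\kappa$, where $\lambda^{<\mu}=\sup\{\lambda^{\nu}:\nu<\mu\text{ a cardinal}\}$. Let $X=\prod_{i\in I}X_i$, with the product topology, where $|I|<\kappa$ and each $X_i$ is a $\mu$-compact GO-space. If the Noetherian type of $X$ is at most $\kappa$, then the density of $X$ is less than $\kappa$. Here a space is $\mu$-compact if every open cover of it has a subcover of size less than $\mu$. A GO-space is a space homeomorphic to a subspace of a linearly ordered set with its order topology. The Noetherian type of $X$ is the least infinite cardinal $\theta$ such that $X$ has a base $\mathcal U$ in which no element of $\mathcal U$ is contained in $\theta$-many elements of $\mathcal U$. The density of $X$ is the least infinite cardinal $\theta$ such that $X$ has a dense subset of size at most $\theta$. -/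

import Mathlib

open Cardinal TopologicalSpace

universe u

namespace GOSpectra

/-- A partially ordered set is `κ`-op-like if no element is below `κ`-many elements. -/
def IsOpLike (κ : Cardinal.{u}) (P : Type u) [PartialOrder P] : Prop :=
  ∀ p : P, ¬ κ ≤ #{q : P // p ≤ q}

/-- The Noetherian type of a space: the least infinite cardinal `κ` such that the space has a base
which is `κ`-op-like when ordered by inclusion. -/
noncomputable def noetherianType (X : Type u) [TopologicalSpace X] : Cardinal.{u} :=
  sInf {κ : Cardinal.{u} | ℵ₀ ≤ κ ∧ ∃ U : Set (Set X), IsTopologicalBasis U ∧ IsOpLike κ U}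

/-- The density of a space: the least infinite cardinal `κ` such that the space has a dense subset
of size at most `κ`. -/
noncomputable def density (X : Type u) [TopologicalSpace X] : Cardinal.{u} :=
  sInf {κ : Cardinal.{u} | ℵ₀ ≤ κ ∧ ∃ D : Set X, Dense D ∧ #D ≤ κ}

/-- A space is `μ`-compact if every open cover has a subcover of size less than `μ`. -/
def IsCardCompact (μ : Cardinal.{u}) (X : Type u) [TopologicalSpace X] : Prop :=
  ∀ A : Set (Set X), (∀ V ∈ A, IsOpen V) → ⋃₀ A = Set.univ →
    ∃ B : Set (Set X), B ⊆ A ∧ ⋃₀ B = Set.univ ∧ #B < μ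

/-- A GO-space (generalized ordered space) is a subspace of a linearly ordered topological space,
that is, of a linear order with its order topology. -/
def IsGOSpace (X : Type u) [TopologicalSpace X] : Prop :=
  ∃ (Y : Type u) (_ : LinearOrder Y) (_ : TopologicalSpace Y) (_ : OrderTopology Y) (f : X → Y),
    Topology.IsEmbedding f

/-- The set of cardinals in the definition of the Noetherian type is never empty. -/
theorem exists_isOpLike_base (X : Type u) [TopologicalSpace X] :
    {κ : Cardinal.{u} | ℵ₀ ≤ κ ∧
      ∃ U : Set (Set X), IsTopologicalBasis U ∧ IsOpLike κ U}.Nonempty := by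
  refine ⟨max ℵ₀ (Order.succ #(Set X)), le_max_left _ _, {V | IsOpen V},
    isTopologicalBasis_opens, fun p h => ?_⟩
  have h1 : #{q : {V : Set X | IsOpen V} // p ≤ q} ≤ #(Set X) :=
    (mk_subtype_le _).trans (mk_set_le _)
  exact absurd ((le_max_right _ _).trans (h.trans h1)) (not_le.2 (Order.lt_succ _))

/-- The set of cardinals in the definition of the density is never empty. -/
theorem exists_dense_card_le (X : Type u) [TopologicalSpace X] :
    {κ : Cardinal.{u} | ℵ₀ ≤ κ ∧ ∃ D : Set X, Dense D ∧ #D ≤ κ}.Nonempty :=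
  ⟨max ℵ₀ #X, le_max_left _ _, Set.univ, dense_univ, (mk_set_le _).trans (le_max_right _ _)⟩

end GOSpectra

/-!
The proof is a closing-off argument. Let `U` be a base of `∏ X i` in which every member has fewer
than `κ` supersets. After replacing a singular `μ` by its successor (`power_lt_of_isSingular`),
the hypothesis on powers gives, for suitable operations on sets of size less than `μ`, a closed set
of size less than `κ` (`exists_closed_set`); this plays the role of an elementary submodel. Its
traces are sets `D i ⊆ X i` and `𝒱 ⊆ U` with `𝒱` of size less than `κ` (`exists_closed_traces`).

If every `D i` is dense, then every nonempty open box contains a nonempty member of `𝒱`, and one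
point from each of these gives a dense set of size less than `κ`.

Otherwise some `D i` is not dense. By `μ`-compactness, a lower set of `X i` that is closed has
cofinality less than `μ`, and dually, so `D i` fills the gap between two of its parts unless one of
them has a limit point inside the gap. Hence there is a
point `a`, a one-sided limit of `D i`, such that `D i` misses a whole interval `[[a, p]]` beyond it
(`exists_limit_of_not_dense`). Let `W ∈ U` contain a point with `i`th coordinate `a` and avoid the
hyperplane `x i = p`. If the other coordinates are well chosen, `W` contains a box of intervals with
end points in the `D j`, hence a nonempty member of `𝒱`; as that member has fewer than `κ`
supersets, `W ∈ 𝒱`. Now slice `W` along the `i`th coordinate. The convex component of the slice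
reaching `a` ends before `p`, and its end is captured by fewer than `μ` points (`exists_ends`), which
lie in `D i` because `W ∈ 𝒱`. One of them falls in `[[a, p]]`, a contradiction.
-/

namespace GOSpectra

open Set Topology

/-! ### Generalized ordered spaces -/

/-- The topology of a linear order makes it a GO-space: open rays are open, and every point has a
neighborhood base of order-convex sets. Unlike `IsGOSpace` this refers to a given order. -/
structure IsGOTopology (X : Type*) [LinearOrder X] [TopologicalSpace X] : Prop where
  isOpen_Iio (a : X) : IsOpen (Iio a)
  isOpen_Ioi (a : X) : IsOpen (Ioi a)
  exists_ordConnected (x : X) (U : Set X) (hU : U ∈ 𝓝 x) : ∃ V ∈ 𝓝 x, V.OrdConnected ∧ V ⊆ U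

theorem IsGOSpace.exists_linearOrder {X : Type u} [TopologicalSpace X] (h : IsGOSpace X) :
    ∃ _ : LinearOrder X, IsGOTopology X := by
  obtain ⟨Y, _, _, _, f, hf⟩ := h
  let _ : LinearOrder X := LinearOrder.lift' f hf.injective
  refine ⟨inferInstance, ⟨fun a => ?_, fun a => ?_, fun x U hU => ?_⟩⟩
  · exact isOpen_Iio.preimage hf.continuous (t := Iio (f a))
  · exact isOpen_Ioi.preimage hf.continuous (t := Ioi (f a))
  · rw [hf.nhds_eq_comap] at hU
    obtain ⟨V, hV, hVU⟩ := hU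
    refine ⟨f ⁻¹' (ordConnectedComponent V (f x)), ?_, ?_, ?_⟩
    · exact hf.continuous.continuousAt (ordConnectedComponent_mem_nhds.2 hV)
    · exact OrdConnected.preimage_mono (f := f) inferInstance fun _ _ h => h
    · exact (preimage_mono ordConnectedComponent_subset).trans hVU

/-- The interval coded by a pair of points: the open interval between them, or a singleton if the
points agree. -/
def codedInterval {X : Type*} [LinearOrder X] (c d : X) : Set X :=
  {x | if c = d then x = c else x ∈ Ioo c d}

theorem codedInterval_of_ne {X : Type*} [LinearOrder X] {c d : X} (hcd : c ≠ d) :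
    codedInterval c d = Ioo c d := by
  ext x; simp [codedInterval, hcd]

theorem codedInterval_self {X : Type*} [LinearOrder X] (c : X) : codedInterval c c = {c} := by
  ext x; simp [codedInterval]

/-- The set `O` contains a nonempty open coded interval with end points in `D`. -/
def ContainsCoded {X : Type*} [LinearOrder X] [TopologicalSpace X] (D O : Set X) : Prop :=
  ∃ c ∈ D, ∃ d ∈ D, IsOpen (codedInterval c d) ∧ (codedInterval c d).Nonempty ∧
    codedInterval c d ⊆ O

namespace IsGOTopology

variable {X : Type u} [LinearOrder X] [TopologicalSpace X]

theorem dual (h : IsGOTopology X) : IsGOTopology Xᵒᵈ where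
  isOpen_Iio a := h.isOpen_Ioi (OrderDual.ofDual a)
  isOpen_Ioi a := h.isOpen_Iio (OrderDual.ofDual a)
  exists_ordConnected x U hU := by
    obtain ⟨V, hV, hc, hVU⟩ := h.exists_ordConnected (OrderDual.ofDual x) U hU
    exact ⟨OrderDual.ofDual ⁻¹' V, hV, hc.dual, hVU⟩

theorem t1Space (h : IsGOTopology X) : T1Space X := by
  refine ⟨fun x => ?_⟩
  rw [← isOpen_compl_iff, ← Iio_union_Ioi]
  exact (h.isOpen_Iio x).union (h.isOpen_Ioi x)

/-- In a `μ`-compact GO-space, a set whose lower closure is closed has cofinality less than `μ`. -/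
theorem exists_cofinal_lt (h : IsGOTopology X) {μ : Cardinal.{u}} (hμ : ℵ₀ ≤ μ)
    (hX : IsCardCompact μ X) {L : Set X} (hL : IsClosed (lowerClosure L : Set X)) :
    ∃ A ⊆ L, #A < μ ∧ ∀ l ∈ L, ∃ a ∈ A, l ≤ a := by
  by_cases hmax : ∃ m ∈ L, ∀ l ∈ L, l ≤ m
  · obtain ⟨m, hm, hmL⟩ := hmax
    refine ⟨{m}, singleton_subset_iff.2 hm, ?_, fun l hl => ⟨m, rfl, hmL l hl⟩⟩
    rw [mk_singleton]
    exact one_lt_aleph0.trans_le hμ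
  push Not at hmax
  obtain ⟨B, hB, hBu, hBμ⟩ := hX (insert (lowerClosure L : Set X)ᶜ (Iio '' L)) (by
      rintro V (rfl | ⟨l, -, rfl⟩)
      exacts [hL.isOpen_compl, h.isOpen_Iio l]) (by
      refine eq_univ_of_forall fun x => ?_
      by_cases hx : x ∈ (lowerClosure L : Set X)
      · obtain ⟨l, hl, hxl⟩ := mem_lowerClosure.1 hx
        obtain ⟨l', hl', hll'⟩ := hmax l hl
        exact ⟨Iio l', Or.inr ⟨l', hl', rfl⟩, hxl.trans_lt hll'⟩
      · exact ⟨_, Or.inl rfl, hx⟩)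
  refine ⟨{l ∈ L | Iio l ∈ B}, sep_subset _ _, lt_of_le_of_lt ?_ hBμ, fun l hl => ?_⟩
  · refine mk_le_of_injective (f := fun l => (⟨Iio l.1, l.2.2⟩ : B)) fun l l' hll' => ?_
    exact Subtype.ext (Iio_injective (congrArg Subtype.val hll'))
  · obtain ⟨V, hVB, hlV⟩ : l ∈ ⋃₀ B := hBu ▸ mem_univ l
    rcases hB hVB with rfl | ⟨l', hl', rfl⟩
    · exact absurd (subset_lowerClosure hl) hlV
    · exact ⟨l', ⟨hl', hVB⟩, hlV.le⟩

/-- If `D` misses a neighborhood of `p` and the part of `D` below `p` has a limit point `a` outside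
its lower closure, then `a` is approached from the left by `D`, while `D` misses `[a, p]`. -/
theorem exists_left_limit (h : IsGOTopology X) {D : Set X} {p : X} (hp : p ∉ closure D)
    (hL : ¬ IsClosed (lowerClosure (D ∩ Iio p) : Set X)) :
    ∃ a, p ≠ a ∧ uIcc a p ∩ D = ∅ ∧ ∀ O ∈ 𝓝 a, ∃ c ∈ D, ∃ d ∈ D, (Ioo c d).Nonempty ∧
      Ioo c d ⊆ O ∧ ∀ e ∈ Ioo c d, a ∈ uIcc e p ∧ uIcc e a ⊆ O := by
  set L := D ∩ Iio p with hLdef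
  obtain ⟨a, ha, haL⟩ : ∃ a, a ∈ closure (lowerClosure L : Set X) ∧ a ∉ lowerClosure L := by
    by_contra! hcon
    exact hL (isClosed_of_closure_subset hcon)
  have hlt : ∀ l ∈ L, l < a := fun l hl =>
    lt_of_not_ge fun hal => haL (mem_lowerClosure.2 ⟨l, hl, hal⟩)
  have hcl : ∀ O ∈ 𝓝 a, ∃ l ∈ L, l ∈ O := by
    intro O hO
    obtain ⟨V, hV, hVc, hVO⟩ := h.exists_ordConnected a O hO
    obtain ⟨x, hxV, hx⟩ := mem_closure_iff_nhds.1 ha V hV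
    obtain ⟨l, hl, hxl⟩ := mem_lowerClosure.1 hx
    exact ⟨l, hl, hVO (hVc.out hxV (mem_of_mem_nhds hV) ⟨hxl, (hlt l hl).le⟩)⟩
  have hne : p ≠ a := by
    rintro rfl
    refine hp (mem_closure_iff_nhds.2 fun O hO => ?_)
    obtain ⟨l, hl, hlO⟩ := hcl O hO
    exact ⟨l, hlO, hl.1⟩
  have hap : a < p := by
    refine lt_of_le_of_ne (le_of_not_gt fun hpa => ?_) hne.symm
    obtain ⟨l, hl, hpl⟩ := hcl _ ((h.isOpen_Ioi p).mem_nhds hpa)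
    exact lt_asymm hl.2 hpl
  refine ⟨a, hne, ?_, fun O hO => ?_⟩
  · rw [uIcc_of_le hap.le, eq_empty_iff_forall_notMem]
    rintro t ⟨⟨hat, htp⟩, htD⟩
    rcases htp.eq_or_lt with rfl | htp
    · exact hp (subset_closure htD)
    · exact (hlt t ⟨htD, htp⟩).not_ge hat
  · obtain ⟨V, hV, hVc, hVO⟩ := h.exists_ordConnected a O hO
    obtain ⟨c, hc, hcV⟩ := hcl V hV
    obtain ⟨e, he, hce⟩ := hcl _ ((h.isOpen_Ioi c).mem_nhds (hlt c hc))
    obtain ⟨d, hd, hed⟩ := hcl _ ((h.isOpen_Ioi e).mem_nhds (hlt e he))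
    have hsub : Icc c a ⊆ O := (hVc.out hcV (mem_of_mem_nhds hV)).trans hVO
    refine ⟨c, hc.1, d, hd.1, ⟨e, hce, hed⟩, fun x hx => hsub ⟨hx.1.le, hx.2.le.trans (hlt d hd).le⟩,
      fun x hx => ?_⟩
    have hxa : x < a := hx.2.trans (hlt d hd)
    rw [uIcc_of_le hxa.le, uIcc_of_le (hxa.trans hap).le]
    exact ⟨⟨hxa.le, hap.le⟩, fun y hy => hsub ⟨hx.1.le.trans hy.1, hy.2⟩⟩

/-- A set `D` that fills every gap between two of its subsets of size less than `μ` (whenever the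
whole space does) can fail to be dense only because some point `a` is a one-sided limit of `D`
beyond which `D` skips an interval `[[a, p]]`. -/
theorem exists_limit_of_not_dense (h : IsGOTopology X) {μ : Cardinal.{u}} (hμ : ℵ₀ ≤ μ)
    (hX : IsCardCompact μ X) {D : Set X}
    (hD : ∀ A ⊆ D, ∀ B ⊆ D, #A < μ → #B < μ → (∃ x, (∀ a ∈ A, a < x) ∧ ∀ b ∈ B, x < b) →
      ∃ x ∈ D, (∀ a ∈ A, a < x) ∧ ∀ b ∈ B, x < b) (hnd : ¬ Dense D) :
    ∃ p a, p ≠ a ∧ uIcc a p ∩ D = ∅ ∧ ∀ O ∈ 𝓝 a, ∃ c ∈ D, ∃ d ∈ D, (Ioo c d).Nonempty ∧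
      Ioo c d ⊆ O ∧ ∀ e ∈ Ioo c d, a ∈ uIcc e p ∧ uIcc e a ⊆ O := by
  obtain ⟨p, hp⟩ : ∃ p, p ∉ closure D := by
    by_contra! hcon
    exact hnd hcon
  by_cases hL : IsClosed (lowerClosure (D ∩ Iio p) : Set X)
  · by_cases hR : IsClosed (upperClosure (D ∩ Ioi p) : Set X)
    · exfalso
      obtain ⟨A, hAL, hAμ, hA⟩ := h.exists_cofinal_lt hμ hX hL
      obtain ⟨B, hBR, hBμ, hB⟩ : ∃ B ⊆ D ∩ Ioi p, #B < μ ∧ ∀ r ∈ D ∩ Ioi p, ∃ b ∈ B, b ≤ r :=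
        h.dual.exists_cofinal_lt hμ hX (L := OrderDual.ofDual ⁻¹' (D ∩ Ioi p)) hR
      obtain ⟨x, hxD, hAx, hxB⟩ := hD A (hAL.trans inter_subset_left) B
        (hBR.trans inter_subset_left) hAμ hBμ ⟨p, fun a ha => (hAL ha).2, fun b hb => (hBR hb).2⟩
      rcases lt_trichotomy x p with hxp | rfl | hpx
      · obtain ⟨a, ha, hxa⟩ := hA x ⟨hxD, hxp⟩
        exact (hAx a ha).not_ge hxa
      · exact hp (subset_closure hxD)
      · obtain ⟨b, hb, hbx⟩ := hB x ⟨hxD, hpx⟩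
        exact (hxB b hb).not_ge hbx
    · obtain ⟨a, hne, hemp, ha⟩ := h.dual.exists_left_limit (D := OrderDual.ofDual ⁻¹' D)
        (p := OrderDual.toDual p) hp hR
      refine ⟨p, OrderDual.ofDual a, hne, ?_, fun O hO => ?_⟩
      · rw [← OrderDual.toDual_ofDual a, uIcc_toDual] at hemp
        exact hemp
      · obtain ⟨c, hc, d, hd, hcd, hO', he⟩ := ha O hO
        rw [← OrderDual.toDual_ofDual c, ← OrderDual.toDual_ofDual d, Ioo_toDual] at *
        refine ⟨OrderDual.ofDual d, hd, OrderDual.ofDual c, hc, hcd, hO', fun e hecd => ?_⟩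
        have := he (OrderDual.toDual e) hecd
        rw [← OrderDual.toDual_ofDual a, uIcc_toDual, uIcc_toDual] at this
        exact this
  · obtain ⟨a, ha⟩ := h.exists_left_limit hp hL
    exact ⟨p, a, ha⟩

/-- The right-hand end of the convex component of `e` in a set `W` is captured by fewer than
`μ` points: either it is the least point above the component, or the component has small
cofinality. -/
theorem exists_right_end (h : IsGOTopology X) {μ : Cardinal.{u}} (hμ : ℵ₀ ≤ μ)
    (hX : IsCardCompact μ X) (W : Set X) (e : X) :
    ∃ G : Set X, #G < μ ∧ ∀ a p, e ≤ a → a ≤ p → Icc e a ⊆ W → p ∉ W → ∃ t ∈ G, t ∈ Icc a p := by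
  set S := ordConnectedComponent W e with hS
  have hSW : S ⊆ W := ordConnectedComponent_subset
  have haS : ∀ a, e ≤ a → Icc e a ⊆ W → a ∈ S := fun a hea ha => by
    rw [hS, mem_ordConnectedComponent, uIcc_of_le hea]
    exact ha
  have hSp : ∀ a p, e ≤ a → a ≤ p → Icc e a ⊆ W → p ∉ W → ∀ s ∈ S, s < p := by
    intro a p hea hap ha hp s hs
    by_contra! hps
    rw [hS, mem_ordConnectedComponent, uIcc_of_le ((hea.trans hap).trans hps)] at hs
    exact hp (hs ⟨hea.trans hap, hps⟩)
  by_cases hcl : IsClosed (lowerClosure S : Set X)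
  · obtain ⟨A, hAS, hAμ, hA⟩ := h.exists_cofinal_lt hμ hX hcl
    refine ⟨A, hAμ, fun a p hea hap ha hp => ?_⟩
    obtain ⟨t, ht, hat⟩ := hA a (haS a hea ha)
    exact ⟨t, ht, hat, (hSp a p hea hap ha hp t (hAS ht)).le⟩
  · obtain ⟨t, ht, htS⟩ : ∃ t, t ∈ closure (lowerClosure S : Set X) ∧ t ∉ lowerClosure S := by
      by_contra! hcon
      exact hcl (isClosed_of_closure_subset hcon)
    refine ⟨{t}, by rw [mk_singleton]; exact one_lt_aleph0.trans_le hμ,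
      fun a p hea hap ha hp => ⟨t, rfl, ?_, ?_⟩⟩
    · exact le_of_not_ge fun hta => htS (mem_lowerClosure.2 ⟨a, haS a hea ha, hta⟩)
    · by_contra! hpt
      obtain ⟨x, hpx, hx⟩ := mem_closure_iff_nhds.1 ht _ ((h.isOpen_Ioi p).mem_nhds hpt)
      obtain ⟨s, hs, hxs⟩ := mem_lowerClosure.1 hx
      exact (hSp a p hea hap ha hp s hs).not_ge (hpx.le.trans hxs)

/-- Fewer than `μ` points suffice to separate a set `W` from its complement, as seen
from `e`: they meet every interval from a point of the convex component of `e` in `W` outwards to a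
point outside `W`. -/
theorem exists_ends (h : IsGOTopology X) {μ : Cardinal.{u}} (hμ : ℵ₀ ≤ μ)
    (hX : IsCardCompact μ X) (W : Set X) (e : X) :
    ∃ G : Set X, #G < μ ∧ ∀ a p, a ∈ uIcc e p → uIcc e a ⊆ W → p ∉ W → ∃ t ∈ G, t ∈ uIcc a p := by
  obtain ⟨G₁, hG₁, h₁⟩ := h.exists_right_end hμ hX W e
  obtain ⟨G₂, hG₂, h₂⟩ := h.dual.exists_right_end hμ hX (OrderDual.ofDual ⁻¹' W)
    (OrderDual.toDual e)
  refine ⟨G₁ ∪ (OrderDual.toDual ⁻¹' G₂ : Set X),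
    (mk_union_le _ _).trans_lt (add_lt_of_lt hμ hG₁ hG₂), fun a p ha haW hp => ?_⟩
  rcases mem_uIcc.1 ha with ⟨hea, hap⟩ | ⟨hpa, hae⟩
  · rw [uIcc_of_le hea] at haW
    obtain ⟨t, ht, htI⟩ := h₁ a p hea hap haW hp
    exact ⟨t, Or.inl ht, by rwa [uIcc_of_le hap]⟩
  · rw [uIcc_of_ge hae] at haW
    obtain ⟨t, ht, htI⟩ := h₂ (OrderDual.toDual a) (OrderDual.toDual p) hae hpa
      (fun x hx => haW ⟨hx.2, hx.1⟩) hp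
    exact ⟨OrderDual.ofDual t, Or.inr ht, by rw [uIcc_of_ge hpa]; exact ⟨htI.2, htI.1⟩⟩

theorem containsCoded_of_Ioo (h : IsGOTopology X) {D O : Set X} {c d : X} (hc : c ∈ D) (hd : d ∈ D)
    (hcd : (Ioo c d).Nonempty) (hO : Ioo c d ⊆ O) : ContainsCoded D O := by
  have hne : c ≠ d := (hcd.elim fun _ hx => (hx.1.trans hx.2).ne)
  refine ⟨c, hc, d, hd, ?_⟩
  rw [codedInterval_of_ne hne]
  exact ⟨(h.isOpen_Ioi c).inter (h.isOpen_Iio d), hcd, hO⟩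

theorem containsCoded_of_dense (h : IsGOTopology X) {D O : Set X} (hD : Dense D) (hO : IsOpen O)
    (hne : O.Nonempty) : ContainsCoded D O := by
  have := h.t1Space
  obtain ⟨q, hq⟩ := hne
  obtain ⟨V, hV, hVc, hVO⟩ := h.exists_ordConnected q O (hO.mem_nhds hq)
  by_cases hiso : ∃ x ∈ interior V, IsOpen {x}
  · obtain ⟨x, hxV, hx⟩ := hiso
    obtain ⟨y, hyx, hyD⟩ := hD.inter_open_nonempty {x} hx ⟨x, rfl⟩
    obtain rfl : y = x := hyx
    refine ⟨y, hyD, y, hyD, ?_⟩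
    rw [codedInterval_self]
    exact ⟨hx, ⟨y, rfl⟩, singleton_subset_iff.2 (hVO (interior_subset hxV))⟩
  · push Not at hiso
    -- Without isolated points, `D` is infinite inside the convex set `V`.
    have hinf : (interior V ∩ D).Infinite := by
      intro hfin
      have hop : IsOpen (interior V \ (interior V ∩ D)) := isOpen_interior.sdiff hfin.isClosed
      have hemp : interior V \ (interior V ∩ D) = ∅ := by
        by_contra hcon
        obtain ⟨y, hy, hyD⟩ := hD.inter_open_nonempty _ hop (nonempty_iff_ne_empty.2 hcon)
        exact hy.2 ⟨hy.1, hyD⟩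
      have hVfin : (interior V).Finite := hfin.subset (sdiff_eq_empty.1 hemp)
      have hqV : q ∈ interior V := mem_interior_iff_mem_nhds.2 hV
      refine hiso q hqV ?_
      have : {q} = interior V \ (interior V \ {q}) := by
        rw [sdiff_sdiff_right_self, inter_singleton_of_mem hqV]
      rw [this]
      exact isOpen_interior.sdiff (hVfin.subset sdiff_subset).isClosed
    obtain ⟨t, ht, htc⟩ := hinf.exists_subset_card_eq 3
    let f := t.orderEmbOfFin htc
    have hf (i : Fin 3) : f i ∈ interior V ∩ D := ht (t.orderEmbOfFin_mem htc i)
    exact h.containsCoded_of_Ioo (hf 0).2 (hf 2).2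
      ⟨f 1, f.strictMono (by decide), f.strictMono (by decide)⟩ fun w hw =>
      hVO (hVc.out (interior_subset (hf 0).1) (interior_subset (hf 2).1) ⟨hw.1.le, hw.2.le⟩)

end IsGOTopology

/-! ### Sets closed under operations on small subsets -/

/-- If `κ ≤ μ`, then `ν = 2 ^< μ < κ` would satisfy `2 ^ ν ≤ ν`. -/
theorem lt_of_powerlt_lt {κ μ : Cardinal.{u}} (hκ : ℵ₀ < κ)
    (hpow : ∀ l < κ, l ^< μ < κ) : μ < κ := by
  by_contra! hle
  have h2 := hpow 2 ((natCast_lt_aleph0 (n := 2)).trans hκ)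
  exact (cantor (2 ^< μ)).not_ge (le_powerlt 2 (h2.trans_le hle))

theorem mk_Iio_ord_lt {μ : Cardinal.{u}} (i : μ.ord.ToType) : #(Iio i) < μ := by
  simpa using mk_Iio_lt i (by simp)

/-- For singular `μ`, a bound on weak powers `l ^< μ` improves to a bound on `l ^ μ`, since
`l ^ μ ≤ (l ^< μ) ^ cof μ`. -/
theorem power_lt_of_isSingular {κ μ : Cardinal.{u}} (hμ : μ.IsSingular)
    (hpow : ∀ l < κ, l ^< μ < κ) (l : Cardinal.{u}) (hl : l < κ) : l ^ μ < κ := by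
  rcases eq_or_ne l 0 with rfl | hl0
  · rwa [zero_power hμ.pos.ne']
  have := noMaxOrder hμ.aleph0_le
  obtain ⟨s, hs, hsc⟩ := Order.exists_cof_eq μ.ord.ToType
  rw [Ordinal.cof_toType] at hsc
  have hle : μ ≤ sum fun i : s => #(Iio i.1) := by
    calc μ = #(⋃ i : s, Iio i.1) := by
          rw [iUnion_coe_set, isCofinal_iff_iUnion_Iio_eq_univ.1 hs, mk_univ, mk_ord_toType]
      _ ≤ _ := mk_iUnion_le_sum_mk
  calc l ^ μ ≤ l ^ sum fun i : s => #(Iio i.1) := power_le_power_left hl0 hle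
    _ = prod fun i : s => l ^ #(Iio i.1) := power_sum _ _
    _ ≤ prod fun _ : s => l ^< μ := prod_le_prod _ _ fun i =>
        le_powerlt _ (mk_Iio_ord_lt i.1)
    _ = (l ^< μ) ^ #s := prod_const' _ _
    _ ≤ (l ^< μ) ^< μ := le_powerlt _ (hsc.trans_lt hμ.cof_ord_lt)
    _ < κ := hpow _ (hpow l hl)

/-- For regular `μ`, subsets of `μ` of size less than `μ` are strictly bounded. -/
theorem exists_forall_lt_of_mk_lt {μ : Cardinal.{u}} (hμ : μ.IsRegular) {s : Set μ.ord.ToType}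
    (hs : #s < μ) : ∃ i, ∀ j ∈ s, j < i := by
  rw [← not_isCofinal_iff]
  intro hcof
  refine (Order.cof_le hcof).not_gt ?_
  rwa [Ordinal.cof_toType, hμ.cof_ord]

theorem mk_small_subsets_lt {κ μ : Cardinal.{u}} (hκ : κ.IsRegular) (hκ_unc : ℵ₀ < κ)
    (hμ : μ.IsRegular) (hpow : ∀ l < κ, l ^< μ < κ) {Ω : Type u} {P : Set Ω} (hP : #P < κ) :
    #{A : Set Ω // A ⊆ P ∧ #A < μ} < κ := by
  have hsub : {A : Set Ω | A ⊆ P ∧ #A < μ} ⊆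
      ⋃ i : μ.ord.ToType, {A : Set Ω | A ⊆ P ∧ #A ≤ #(Iio i)} := by
    rintro A ⟨hAP, hA⟩
    obtain ⟨f⟩ : Nonempty (A ↪ μ.ord.ToType) := by
      rw [← Cardinal.le_def, mk_ord_toType]
      exact hA.le
    obtain ⟨i, hi⟩ := exists_forall_lt_of_mk_lt hμ (s := range f) (mk_range_le.trans_lt hA)
    refine mem_iUnion.2 ⟨i, hAP, mk_le_of_injective (f := fun a => ⟨f a, hi _ ⟨a, rfl⟩⟩) ?_⟩
    intro a b hab
    exact f.injective (congrArg Subtype.val hab)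
  refine (mk_le_mk_of_subset hsub).trans_lt
    ((card_iUnion_lt_iff_forall_of_isRegular hκ ?_).2 fun i => ?_)
  · rw [mk_ord_toType]
    exact lt_of_powerlt_lt hκ_unc hpow
  · exact (mk_bounded_subset_le P _).trans_lt
      ((le_powerlt _ (mk_Iio_ord_lt i)).trans_lt (hpow _ (max_lt hP hκ_unc)))

/-- An operation on sets of size less than `μ`, with values of size less than `κ`, has a closed set
of size less than `κ`: iterate the operation along `μ`. -/
theorem exists_closed_set {κ μ : Cardinal.{u}} (hκ : κ.IsRegular) (hκ_unc : ℵ₀ < κ)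
    (hμ : μ.IsRegular) (hpow : ∀ l < κ, l ^< μ < κ) {Ω : Type u} (F : Set Ω → Set Ω)
    (hF : ∀ A : Set Ω, #A < μ → #(F A) < κ) :
    ∃ M : Set Ω, #M < κ ∧ ∀ A ⊆ M, #A < μ → F A ⊆ M := by
  have hμκ := lt_of_powerlt_lt hκ_unc hpow
  -- `Q P` adds to `P` the values of `F` on all small subsets of `P`.
  let Q : Set Ω → Set Ω := fun P => P ∪ ⋃ A : {A : Set Ω // A ⊆ P ∧ #A < μ}, F A
  have hQ : ∀ P : Set Ω, #P < κ → #(Q P) < κ := fun P hP =>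
    (mk_union_le _ _).trans_lt (add_lt_of_lt hκ.aleph0_le hP
      ((card_iUnion_lt_iff_forall_of_isRegular hκ
        (mk_small_subsets_lt hκ hκ_unc hμ hpow hP)).2 fun A => hF _ A.2.2))
  let P : μ.ord.ToType → Set Ω := WellFoundedLT.fix fun a ih => ⋃ b : Iio a, Q (ih b.1 b.2)
  have hP : ∀ a, P a = ⋃ b : Iio a, Q (P b) := fun a =>
    WellFoundedLT.fix_eq (fun a ih => ⋃ b : Iio a, Q (ih b.1 b.2)) a
  have hlt : ∀ {a b}, a < b → Q (P a) ⊆ P b := by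
    intro a b hab
    rw [hP b]
    exact subset_iUnion (fun b' : Iio b => Q (P b')) ⟨a, hab⟩
  refine ⟨⋃ a, P a, (card_iUnion_lt_iff_forall_of_isRegular hκ (by rwa [mk_ord_toType])).2 ?_, ?_⟩
  · intro a
    induction a using WellFoundedLT.induction with
    | ind a ih =>
      rw [hP a]
      exact (card_iUnion_lt_iff_forall_of_isRegular hκ
        ((mk_Iio_ord_lt a).trans hμκ)).2 fun b => hQ _ (ih b.1 b.2)
  · intro A hA hAμ
    choose f hf using fun a : A => mem_iUnion.1 (hA a.2)
    obtain ⟨i, hi⟩ := exists_forall_lt_of_mk_lt hμ (s := range f) (mk_range_le.trans_lt hAμ)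
    have := noMaxOrder hμ.aleph0_le
    obtain ⟨j, hij⟩ := exists_gt i
    have hAi : A ⊆ P i := fun a ha =>
      hlt (hi _ ⟨⟨a, ha⟩, rfl⟩) (Or.inl (hf ⟨a, ha⟩))
    have hFQ : F A ⊆ Q (P i) := fun x hx => Or.inr (mem_iUnion.2 ⟨⟨A, hAi, hAμ⟩, hx⟩)
    exact (hFQ.trans (hlt hij)).trans (subset_iUnion P j)

/-! ### Products of GO-spaces -/

/-- A substitute for a small elementary submodel containing the base `U`. The sets `D i` and `𝒱` are
its traces on the factors and on `U`: the `D i` fill gaps, every box of coded intervals with end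
points in `D` contains a nonempty member of `𝒱`, supersets in `U` of members of `𝒱` lie in `𝒱`, and
the ends of slices of members of `𝒱` are captured by `D`. -/
theorem exists_closed_traces {κ μ : Cardinal.{u}} (hκ : κ.IsRegular) (hκ_unc : ℵ₀ < κ)
    (hμ : μ.IsRegular) (hpow : ∀ l < κ, l ^< μ < κ) {ι : Type u} [DecidableEq ι] (hι : #ι < κ)
    {X : ι → Type u}
    [∀ i, LinearOrder (X i)] [∀ i, TopologicalSpace (X i)] [∀ i, Nonempty (X i)]
    (hX : ∀ i, IsGOTopology (X i)) (hcpt : ∀ i, IsCardCompact μ (X i))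
    {U : Set (Set (∀ i, X i))} (hU : IsTopologicalBasis U) (hop : IsOpLike κ U) :
    ∃ (D : ∀ i, Set (X i)) (𝒱 : Set (Set (∀ i, X i))), #𝒱 < κ ∧
      (∀ i, ∀ A ⊆ D i, ∀ B ⊆ D i, #A < μ → #B < μ → (∃ x, (∀ a ∈ A, a < x) ∧ ∀ b ∈ B, x < b) →
        ∃ x ∈ D i, (∀ a ∈ A, a < x) ∧ ∀ b ∈ B, x < b) ∧
      (∀ (F : Finset ι) (O : ∀ i, Set (X i)), (∀ i, ContainsCoded (D i) (O i)) →
        ∃ V ∈ 𝒱, V.Nonempty ∧ ∀ x ∈ V, ∀ i ∈ F, x i ∈ O i) ∧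
      (∀ V ∈ 𝒱, ∀ W ∈ U, V ⊆ W → W ∈ 𝒱) ∧
      ∀ V ∈ 𝒱, V.Nonempty → ∀ W ∈ 𝒱, ∃ r ∈ V, ∀ i, ∀ a p, a ∈ uIcc (r i) p →
        (∀ x ∈ uIcc (r i) a, Function.update r i x ∈ W) → Function.update r i p ∉ W →
          ∃ t ∈ D i, t ∈ uIcc a p := by
  have hμ₀ := hμ.aleph0_le
  have hμκ := lt_of_powerlt_lt hκ_unc hpow
  have h2 : ∀ c < μ, (2 : Cardinal.{u}) ^ c < κ := fun c hc =>
    (le_powerlt 2 hc).trans_lt (hpow 2 ((natCast_lt_aleph0 (n := 2)).trans hκ_unc))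
  let Ω := (Σ i, X i) ⊕ Set (∀ i, X i)
  let pts : Set Ω → ∀ i, Set (X i) := fun A i => {x | Sum.inl ⟨i, x⟩ ∈ A}
  let sets : Set Ω → Set (Set (∀ i, X i)) := fun A => {V | Sum.inr V ∈ A}
  have hsets : ∀ A, #(sets A) ≤ #A := fun A =>
    mk_le_of_injective (f := fun V => (⟨Sum.inr V.1, V.2⟩ : A)) fun V W h =>
      Subtype.ext (Sum.inr_injective (congrArg Subtype.val h))
  -- a point in the gap between `A` and `B`
  let fill : ∀ i, Set (X i) → Set (X i) → X i := fun i A B =>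
    Classical.epsilon fun x => (∀ a ∈ A, a < x) ∧ ∀ b ∈ B, x < b
  -- a member of the base inside the box coded by `E`
  let box : Set (Ω × Ω) → Set (∀ i, X i) := fun E =>
    {x | ∀ i c d, ((Sum.inl ⟨i, c⟩, Sum.inl ⟨i, d⟩) : Ω × Ω) ∈ E → x i ∈ codedInterval c d}
  let sub : Set (Ω × Ω) → Set (∀ i, X i) := fun E =>
    Classical.epsilon fun V => V ∈ U ∧ V.Nonempty ∧ V ⊆ box E
  let r : Set (∀ i, X i) → ∀ i, X i := fun V => Classical.epsilon fun x => x ∈ V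
  choose G hGμ hG using fun (i : ι) (V W : Set (∀ i, X i)) =>
    (hX i).exists_ends hμ₀ (hcpt i) {x | Function.update (r V) i x ∈ W} (r V i)
  let F₁ : Set Ω → Set Ω := fun A => range fun z : ι × 𝒫 A × 𝒫 A =>
    Sum.inl ⟨z.1, fill z.1 (pts z.2.1 z.1) (pts z.2.2 z.1)⟩
  let F₂ : Set Ω → Set Ω := fun A => range fun E : 𝒫 (A ×ˢ A) => Sum.inr (sub E)
  let F₃ : Set Ω → Set Ω := fun A => ⋃ V : {V : U // Sum.inr V.1 ∈ A},
    range fun W : {W : U // V.1 ≤ W} => Sum.inr W.1.1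
  let F₄ : Set Ω → Set Ω := fun A => ⋃ z : ι × sets A × sets A,
    (fun t => Sum.inl ⟨z.1, t⟩) '' G z.1 z.2.1 z.2.2
  obtain ⟨M, hMκ, hM⟩ := exists_closed_set hκ hκ_unc hμ hpow
    (fun A => F₁ A ∪ (F₂ A ∪ (F₃ A ∪ F₄ A))) (by
      intro A hA
      have hAκ := hA.trans hμκ
      have hun : ∀ S T : Set Ω, #S < κ → #T < κ → #(S ∪ T : Set Ω) < κ := fun S T hS hT =>
        (mk_union_le S T).trans_lt (add_lt_of_lt hκ.aleph0_le hS hT)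
      have hmul : ∀ {a b : Cardinal.{u}}, a < κ → b < κ → a * b < κ :=
        fun ha hb => mul_lt_of_lt hκ.aleph0_le ha hb
      refine hun _ _ ?_ (hun _ _ ?_ (hun _ _ ?_ ?_))
      · refine mk_range_le.trans_lt ?_
        simp only [mk_prod, lift_id, mk_powerset]
        exact hmul hι (hmul (h2 _ hA) (h2 _ hA))
      · refine mk_range_le.trans_lt ?_
        simp only [mk_powerset, mk_setProd]
        exact h2 _ (mul_lt_of_lt hμ₀ hA hA)
      · refine (card_iUnion_lt_iff_forall_of_isRegular hκ ?_).2 fun V =>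
          mk_range_le.trans_lt (not_le.1 (hop V.1))
        refine (mk_le_of_injective (f := fun V => (⟨V.1.1, V.2⟩ : sets A)) fun V W h => ?_).trans_lt
          ((hsets A).trans_lt hAκ)
        exact Subtype.ext (Subtype.ext (Subtype.mk.inj h))
      · refine (card_iUnion_lt_iff_forall_of_isRegular hκ ?_).2 fun z =>
          mk_image_le.trans_lt ((hGμ _ _ _).trans hμκ)
        simp only [mk_prod, lift_id]
        have := (hsets A).trans_lt hAκ
        exact hmul hι (hmul this this))
  have hfin : ∀ A : Set Ω, A.Finite → #A < μ := fun A hA => hA.lt_aleph0.trans_le hμ₀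
  have himg : ∀ i (A : Set (X i)), #A < μ → #((fun x => Sum.inl ⟨i, x⟩ : X i → Ω) '' A) < μ :=
    fun i A hA => mk_image_le.trans_lt hA
  have hpts : ∀ i (A : Set (X i)), pts ((fun x => Sum.inl ⟨i, x⟩ : X i → Ω) '' A) i = A := by
    intro i A
    ext x
    simp [pts]
  refine ⟨pts M, U ∩ sets M, ?_, ?_, ?_, ?_, ?_⟩
  · exact (mk_le_mk_of_subset inter_subset_right).trans_lt ((hsets M).trans_lt hMκ)
  · intro i A hA B hB hAμ hBμ hex
    let A' : Set Ω := (fun x => Sum.inl ⟨i, x⟩) '' A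
    let B' : Set Ω := (fun x => Sum.inl ⟨i, x⟩) '' B
    refine ⟨fill i A B, ?_, Classical.epsilon_spec hex⟩
    have hsub : A' ∪ B' ⊆ M := by
      rintro _ (⟨x, hx, rfl⟩ | ⟨x, hx, rfl⟩)
      exacts [hA hx, hB hx]
    have := hM (A' ∪ B') hsub ((mk_union_le _ _).trans_lt
      (add_lt_of_lt hμ₀ (himg i A hAμ) (himg i B hBμ)))
    refine this (Or.inl ⟨(i, ⟨A', subset_union_left⟩, ⟨B', subset_union_right⟩), ?_⟩)
    simp only [A', B', hpts]
  · intro F O hO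
    choose c hc d hd hop hne hsub using hO
    let E : Set (Ω × Ω) := (fun i => (Sum.inl ⟨i, c i⟩, Sum.inl ⟨i, d i⟩)) '' (F : Set ι)
    have hE : E.Finite := F.finite_toSet.image _
    let A : Set Ω := Prod.fst '' E ∪ Prod.snd '' E
    have hbox : box E = (F : Set ι).pi fun i => codedInterval (c i) (d i) := by
      ext x
      constructor
      · intro hx i hi
        exact hx i _ _ ⟨i, hi, rfl⟩
      · rintro hx i c' d' ⟨j, hj, hjE⟩
        obtain ⟨h₁, h₂⟩ := Prod.mk.inj hjE
        obtain ⟨rfl, h₁⟩ := Sigma.mk.inj (Sum.inl_injective h₁)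
        obtain ⟨-, h₂⟩ := Sigma.mk.inj (Sum.inl_injective h₂)
        obtain rfl := eq_of_heq h₁
        obtain rfl := eq_of_heq h₂
        exact hx j hj
    have hex : ∃ V, V ∈ U ∧ V.Nonempty ∧ V ⊆ box E := by
      choose y hy using hne
      have hyb : y ∈ box E := by
        rw [hbox]
        exact fun i _ => hy i
      obtain ⟨V, hV, hyV, hVb⟩ := hU.exists_subset_of_mem_open hyb (by
        rw [hbox]
        exact isOpen_set_pi F.finite_toSet fun i _ => hop i)
      exact ⟨V, hV, ⟨y, hyV⟩, hVb⟩
    obtain ⟨h₁, h₂, h₃⟩ : sub E ∈ U ∧ (sub E).Nonempty ∧ sub E ⊆ box E :=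
      Classical.epsilon_spec hex
    refine ⟨sub E, ⟨h₁, ?_⟩, h₂, fun x hx i hi => ?_⟩
    · have hAM : A ⊆ M := by
        rintro _ (⟨_, ⟨i, -, rfl⟩, rfl⟩ | ⟨_, ⟨i, -, rfl⟩, rfl⟩)
        exacts [hc i, hd i]
      refine hM A hAM (hfin A ((hE.image _).union (hE.image _))) (Or.inr (Or.inl ⟨⟨E, ?_⟩, rfl⟩))
      exact fun e he => ⟨Or.inl ⟨e, he, rfl⟩, Or.inr ⟨e, he, rfl⟩⟩
    · have := h₃ hx
      rw [hbox] at this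
      exact hsub i (this i hi)
  · rintro V ⟨hVU, hVM⟩ W hW hVW
    refine ⟨hW, hM {Sum.inr V} (singleton_subset_iff.2 hVM) (hfin _ (finite_singleton _))
      (Or.inr (Or.inr (Or.inl ?_)))⟩
    exact mem_iUnion.2 ⟨⟨⟨V, hVU⟩, rfl⟩, ⟨⟨⟨W, hW⟩, hVW⟩, rfl⟩⟩
  · rintro V ⟨-, hVM⟩ hVne W ⟨-, hWM⟩
    refine ⟨r V, Classical.epsilon_spec hVne, fun i a p ha haW hp => ?_⟩
    obtain ⟨t, ht, hta⟩ := hG i V W a p ha haW hp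
    refine ⟨t, hM {Sum.inr V, Sum.inr W} (insert_subset hVM (singleton_subset_iff.2 hWM))
      (hfin _ (toFinite _)) (Or.inr (Or.inr (Or.inr ?_))), hta⟩
    exact mem_iUnion.2 ⟨(i, ⟨V, Or.inl rfl⟩, ⟨W, Or.inr rfl⟩), ⟨t, ht, rfl⟩⟩

theorem density_le {X : Type u} [TopologicalSpace X] {κ : Cardinal.{u}} (hκ : ℵ₀ ≤ κ) {D : Set X}
    (hD : Dense D) (hDκ : #D ≤ κ) : density X ≤ κ :=
  csInf_le' ⟨hκ, D, hD, hDκ⟩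

/-- The infimum in the definition of the Noetherian type is attained, and being `θ`-op-like is
monotone in `θ`. -/
theorem exists_isOpLike_of_noetherianType_le {X : Type u} [TopologicalSpace X] {κ : Cardinal.{u}}
    (h : noetherianType X ≤ κ) : ∃ U : Set (Set X), IsTopologicalBasis U ∧ IsOpLike κ U := by
  obtain ⟨-, U, hU, hop⟩ := csInf_mem (exists_isOpLike_base X)
  exact ⟨U, hU, fun p hp => hop p (h.trans hp)⟩

/-- The density bound for regular `μ`, where the factors carry linear orders inducing their
GO-topologies. -/
theorem density_pi_lt_of_isRegular {κ μ : Cardinal.{u}} (hκ : κ.IsRegular) (hκ_unc : ℵ₀ < κ)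
    (hμ : μ.IsRegular) (hpow : ∀ l < κ, l ^< μ < κ) {ι : Type u} (hι : #ι < κ) {X : ι → Type u}
    [∀ i, LinearOrder (X i)] [∀ i, TopologicalSpace (X i)] [∀ i, Nonempty (X i)]
    (hX : ∀ i, IsGOTopology (X i)) (hcpt : ∀ i, IsCardCompact μ (X i))
    (hNt : noetherianType (∀ i, X i) ≤ κ) : density (∀ i, X i) < κ := by
  classical
  obtain ⟨U, hU, hop⟩ := exists_isOpLike_of_noetherianType_le hNt
  obtain ⟨D, 𝒱, h𝒱κ, hfill, hbox, hsup, hends⟩ :=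
    exists_closed_traces hκ hκ_unc hμ hpow hι hX hcpt hU hop
  by_cases hdense : ∀ i, Dense (D i)
  · -- One point from each nonempty member of `𝒱` gives a dense set.
    have hD : Dense (range fun V : {V : 𝒱 // V.1.Nonempty} => V.2.some) := by
      refine dense_iff_inter_open.2 fun W hW ⟨y, hy⟩ => ?_
      obtain ⟨F, u, hu, huW⟩ := isOpen_pi_iff.1 hW y hy
      obtain ⟨V, hV, hVne, hVu⟩ := hbox F (fun i => if i ∈ F then u i else univ) fun i => by
        refine (hX i).containsCoded_of_dense (hdense i) ?_ ⟨y i, ?_⟩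
        all_goals split_ifs with hi
        exacts [(hu i hi).1, isOpen_univ, (hu i hi).2, mem_univ _]
      refine ⟨_, huW fun i hi => ?_, ⟨⟨⟨V, hV⟩, hVne⟩, rfl⟩⟩
      simpa only [if_pos (Finset.mem_coe.1 hi)] using hVu _ hVne.some_mem i hi
    refine (density_le (le_max_left ℵ₀ #𝒱) hD ?_).trans_lt (max_lt hκ_unc h𝒱κ)
    exact (mk_range_le.trans (mk_subtype_le _)).trans (le_max_right _ _)
  exfalso
  push Not at hdense
  obtain ⟨i, hi⟩ := hdense
  obtain ⟨p, a, hpa, hgap, hlim⟩ :=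
    (hX i).exists_limit_of_not_dense hμ.aleph0_le (hcpt i) (hfill i) hi
  -- Every factor has a point all of whose neighborhoods contain coded intervals.
  have hq : ∀ j, ∃ q : X j, ∀ O ∈ 𝓝 q, ContainsCoded (D j) O := by
    intro j
    by_cases hj : Dense (D j)
    · refine ⟨Classical.arbitrary _, fun O hO => ?_⟩
      obtain ⟨c, hc, d, hd, h₁, h₂, h₃⟩ := (hX j).containsCoded_of_dense hj isOpen_interior
        ⟨_, mem_interior_iff_mem_nhds.2 hO⟩
      exact ⟨c, hc, d, hd, h₁, h₂, h₃.trans interior_subset⟩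
    · obtain ⟨_, q, -, -, hq⟩ :=
        (hX j).exists_limit_of_not_dense hμ.aleph0_le (hcpt j) (hfill j) hj
      refine ⟨q, fun O hO => ?_⟩
      obtain ⟨c, hc, d, hd, hcd, hO', -⟩ := hq O hO
      exact (hX j).containsCoded_of_Ioo hc hd hcd hO'
  choose q hq using hq
  have := (hX i).t1Space
  obtain ⟨W, hWU, hqW, hWp⟩ := hU.exists_subset_of_mem_open
    (show Function.update q i a ∈ (fun x : ∀ j, X j => x i) ⁻¹' {p}ᶜ by simpa using hpa.symm)
    (isOpen_compl_singleton.preimage (continuous_apply i))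
  obtain ⟨F, u, hu, huW⟩ := isOpen_pi_iff.1 (hU.isOpen hWU) _ hqW
  let O : ∀ j, Set (X j) := fun j => if j ∈ F then u j else univ
  have hO : ∀ j, O j ∈ 𝓝 (Function.update q i a j) := by
    intro j
    by_cases hj : j ∈ F
    · simpa only [O, if_pos hj] using (hu j hj).1.mem_nhds (hu j hj).2
    · simp only [O, if_neg hj, Filter.univ_mem]
  have hOW : ∀ x : ∀ j, X j, (∀ j ∈ insert i F, x j ∈ O j) → x ∈ W := fun x hx => huW fun j hj => by
    simpa only [O, if_pos (Finset.mem_coe.1 hj)] using hx j (Finset.mem_insert_of_mem hj)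
  obtain ⟨c, hc, d, hd, hcd, hcdO, he⟩ := hlim (O i) (by simpa using hO i)
  -- Shrinking the `i`th side of the box to `Ioo c d` keeps it on one side of `a`.
  obtain ⟨V, hV, hVne, hVO⟩ := hbox (insert i F) (Function.update O i (Ioo c d)) fun j => by
    rcases eq_or_ne j i with rfl | hj
    · rw [Function.update_self]
      exact (hX j).containsCoded_of_Ioo hc hd hcd subset_rfl
    · rw [Function.update_of_ne hj]
      have := hO j
      rw [Function.update_of_ne hj] at this
      exact hq j _ this
  have hVi : ∀ x ∈ V, x i ∈ Ioo c d := fun x hx => by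
    simpa using hVO x hx i (Finset.mem_insert_self i F)
  have hVj : ∀ x ∈ V, ∀ j ∈ insert i F, x j ∈ O j := by
    intro x hx j hj
    rcases eq_or_ne j i with rfl | hji
    · exact hcdO (hVi x hx)
    · simpa only [Function.update_of_ne hji] using hVO x hx j hj
  -- The base element `W` contains a member of `𝒱`, so it belongs to `𝒱` as well.
  have hW𝒱 : W ∈ 𝒱 := hsup V hV W hWU fun x hx => hOW x (hVj x hx)
  obtain ⟨r, hrV, hr⟩ := hends V hV hVne W hW𝒱
  obtain ⟨hab, hsub⟩ := he (r i) (hVi r hrV)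
  obtain ⟨t, htD, ht⟩ := hr i a p hab (fun x hx => hOW _ fun j hj => by
      rcases eq_or_ne j i with rfl | hji
      · rw [Function.update_self]
        exact hsub hx
      · rw [Function.update_of_ne hji]
        exact hVj r hrV j hj)
    (fun hpW => by simpa using hWp hpW)
  exact (eq_empty_iff_forall_notMem.1 hgap t) ⟨ht, htD⟩

theorem IsCardCompact.mono {μ ν : Cardinal.{u}} (h : μ ≤ ν) {X : Type u} [TopologicalSpace X]
    (hX : IsCardCompact μ X) : IsCardCompact ν X := fun A hA hAu =>
  let ⟨B, hBA, hBu, hB⟩ := hX A hA hAu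
  ⟨B, hBA, hBu, hB.trans_le h⟩

end GOSpectra

theorem mainTheorem1 (κ μ : Cardinal.{u}) (hκ : κ.IsRegular) (hκ_unc : ℵ₀ < κ) (hμ : ℵ₀ ≤ μ)
    (hpow : ∀ l : Cardinal.{u}, l < κ → l ^< μ < κ)
    (ι : Type u) (hι : #ι < κ)
    (X : ι → Type u) [∀ i, TopologicalSpace (X i)]
    (hGO : ∀ i, GOSpectra.IsGOSpace (X i))
    (hcpt : ∀ i, GOSpectra.IsCardCompact μ (X i))
    (hNt : GOSpectra.noetherianType (∀ i, X i) ≤ κ) :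
    GOSpectra.density (∀ i, X i) < κ := by
  by_cases hne : ∀ i, Nonempty (X i)
  · choose o ho using fun i => (hGO i).exists_linearOrder
    rcases isRegular_or_isSingular hμ with hμr | hμs
    · exact GOSpectra.density_pi_lt_of_isRegular hκ hκ_unc hμr hpow hι ho hcpt hNt
    · -- For singular `μ`, pass to its successor, which satisfies the same power condition.
      refine GOSpectra.density_pi_lt_of_isRegular hκ hκ_unc (isRegular_succ hμ) (fun l hl => ?_) hι ho
        (fun i => (hcpt i).mono (Order.le_succ μ)) hNt
      rcases eq_or_ne l 0 with rfl | hl0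
      · exact (powerlt_le.2 fun x _ => zero_power_le x).trans_lt (one_lt_aleph0.trans hκ_unc)
      · rw [powerlt_succ hl0]
        exact GOSpectra.power_lt_of_isSingular hμs hpow l hl
  · have : IsEmpty (∀ i, X i) := by
      simpa using hne
    refine (GOSpectra.density_le le_rfl (D := ∅) (fun x => isEmptyElim x) ?_).trans_lt hκ_unc
    simp
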